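/- Setting. An MDP $\nu$ consists of a state space $\mathcal S$, an action space $\mathcal A$, a transition model $P(\cdot\mid s,a)$, a reward function $\mathcal R(s,a)$, a discount factor $\gamma\in[0,1]$ and an initial-state distribution $\mu$. A policy $\pi_\theta(\cdot\mid s)$, run for $H$ steps in $\nu$, induces the law $p^{\nu}_{\theta}$ of the trajectory $\tau=(s_0,a_0,\dots,s_{H-1},a_{H-1})$, with $s_0\sim\mu$, $a_h\sim\pi_\theta(\cdot\mid s_h)$, $s_{h+1}\sim P(\cdot\mid s_h,a_h)$; its return is $\mathcal R(\tau)=\sum_{h<H}\gamma^h\mathcal R(s_h,a_h)$, and $J^\nu(\theta)=\mathbb E_{\tau\sim p_\theta^\nu}[\mathcal R(\tau)]$. An algorithm selects in each round $t$ a parameter $\theta_t\in\Theta$, possibly at random, on the basis of the history $(\theta_i,\tau_i,\mathcal R(\tau_i))_{i<t}$, and then observes a trajectory $\tau_t\sim p^\nu_{\theta_t}$ and its return. Its expected regret after $n$ rounds in $\nu$ is $\mathbb E_\nu R(n)=\mathbb E_\nu\sum_{t=1}^n\bigl(\sup_{\theta\in\Theta}J^\nu(\theta)-J^\nu(\theta_t)\bigr)$.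 Theorem. For every $\Delta>0$ there exist two MDPs $\nu_1,\nu_2$ with $\mathcal S=\mathcal A=\mathbb R$ and horizon $H=2$, which differ only in their transition model, and a parameter space $\Theta=\{\theta_1,\theta_2\}$ with $\pi_{\theta_1}(\cdot\mid s)=\mathcal N(1,1)$ and $\pi_{\theta_2}(\cdot\mid s)=\delta_0$ for all $s$, such that, for both $\nu\in\{\nu_1,\nu_2\}$, returns are integrable under $p^\nu_{\theta_1}$ and $p^\nu_{\theta_2}$, $$D_{\mathrm{KL}}(p^{\nu}_{\theta_1}\,\|\,p^{\nu}_{\theta_2})=D_{\mathrm{KL}}(p^{\nu}_{\theta_2}\,\|\,p^{\nu}_{\theta_1})=\infty,$$ such that $$J^{\nu_1}(\theta_1)-J^{\nu_1}(\theta_2)=\Delta,\qquad J^{\nu_2}(\theta_2)-J^{\nu_2}(\theta_1)=\Delta,$$ and such that, for every $n\ge1$ and every algorithm (the same algorithm being run in either MDP), $$\max\bigl\{\mathbb E_{\nu_1}R(n),\ \mathbb E_{\nu_2}R(n)\bigr\}\ \ge\ \frac{1}{8\Delta}\,\log(\Delta^2 n).$$ -/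

import Mathlib

open MeasureTheory ProbabilityTheory

noncomputable section

namespace MediatorFeedback

/-! ### Laws of finite sequences generated step by step -/

section SeqLaw

variable {X : Type*} [MeasurableSpace X]

/-- The law of `(x₀, …, x_{n-1})` when each `x_k` is drawn from `κ k (x₀, …, x_{k-1})`. -/
def seqLaw (κ : (k : ℕ) → Kernel (Fin k → X) X) : (n : ℕ) → Measure (Fin n → X)
  | 0 => Measure.dirac Fin.elim0
  | n + 1 => (seqLaw κ n ⊗ₘ κ n).map fun p => Fin.snoc (α := fun _ => X) p.1 p.2

theorem measurable_snoc (n : ℕ) :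
    Measurable fun p : (Fin n → X) × X => (Fin.snoc (α := fun _ => X) p.1 p.2 : Fin (n + 1) → X) := by
  refine measurable_pi_lambda _ fun i => ?_
  refine Fin.lastCases ?_ (fun j => ?_) i
  · simpa using measurable_snd
  · simpa [Function.comp_def] using (measurable_pi_apply j).comp (measurable_fst (β := X))

instance isProbabilityMeasure_seqLaw (κ : (k : ℕ) → Kernel (Fin k → X) X)
    [∀ k, IsMarkovKernel (κ k)] (n : ℕ) : IsProbabilityMeasure (seqLaw κ n) := by
  induction n with
  | zero => rw [seqLaw]; infer_instance
  | succ n ih =>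
    rw [seqLaw]
    exact Measure.isProbabilityMeasure_map (measurable_snoc n).aemeasurable

end SeqLaw

/-! ### Markov decision processes, policies and trajectories -/

/-- A discrete-time Markov decision process with state space `S` and action space `A`. -/
structure MDP (S A : Type*) [MeasurableSpace S] [MeasurableSpace A] where
  /-- the transition model -/
  trans : Kernel (S × A) S
  isMarkovKernel_trans : IsMarkovKernel trans
  /-- the reward function -/
  reward : S × A → ℝ
  measurable_reward : Measurable reward
  /-- the discount factor -/
  discount : ℝ
  discount_mem : discount ∈ Set.Icc (0 : ℝ) 1
  /-- the initial-state distribution -/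
  init : Measure S
  isProbabilityMeasure_init : IsProbabilityMeasure init

attribute [instance] MDP.isMarkovKernel_trans MDP.isProbabilityMeasure_init

/-- A (stochastic, Markovian) policy. -/
structure Policy (S A : Type*) [MeasurableSpace S] [MeasurableSpace A] where
  /-- the action distribution in each state -/
  act : Kernel S A
  isMarkovKernel_act : IsMarkovKernel act

attribute [instance] Policy.isMarkovKernel_act

/-- Trajectories `(s₀, a₀, …, s_{H-1}, a_{H-1})` of length `H`. -/
abbrev Trajectory (S A : Type*) (H : ℕ) := Fin H → S × A

namespace MDP

variable {S A : Type*} [MeasurableSpace S] [MeasurableSpace A]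

/-- The law of the state `s_h` given `(s₀, a₀, …, s_{h-1}, a_{h-1})`: the initial distribution
if `h = 0`, and the transition model at `(s_{h-1}, a_{h-1})` otherwise. -/
def stateKernel (M : MDP S A) : (h : ℕ) → Kernel (Trajectory S A h) S
  | 0 => Kernel.const _ M.init
  | h + 1 => M.trans.comap (fun τ => τ (Fin.last h)) (measurable_pi_apply _)

instance (M : MDP S A) (h : ℕ) : IsMarkovKernel (M.stateKernel h) := by
  cases h <;> rw [stateKernel] <;> infer_instance

/-- The law of `(s_h, a_h)` given `(s₀, a₀, …, s_{h-1}, a_{h-1})`, actions being drawn from `π`. -/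
def stepKernel (M : MDP S A) (π : Policy S A) (h : ℕ) : Kernel (Trajectory S A h) (S × A) :=
  M.stateKernel h ⊗ₖ Kernel.prodMkLeft (Trajectory S A h) π.act

instance (M : MDP S A) (π : Policy S A) (h : ℕ) : IsMarkovKernel (M.stepKernel π h) := by
  rw [stepKernel]; infer_instance

/-- The trajectory distribution `p_π` induced by the policy `π`, for trajectories of length `H`. -/
def trajLaw (M : MDP S A) (π : Policy S A) (H : ℕ) : Measure (Trajectory S A H) :=
  seqLaw (M.stepKernel π) H

instance (M : MDP S A) (π : Policy S A) (H : ℕ) : IsProbabilityMeasure (M.trajLaw π H) := by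
  rw [trajLaw]; infer_instance

/-- The (discounted) return of a trajectory. -/
def ret (M : MDP S A) {H : ℕ} (τ : Trajectory S A H) : ℝ :=
  ∑ h : Fin H, M.discount ^ (h : ℕ) * M.reward (τ h)

theorem measurable_ret (M : MDP S A) (H : ℕ) :
    Measurable (M.ret : Trajectory S A H → ℝ) := by
  unfold ret
  exact Finset.measurable_sum _ fun h _ =>
    (M.measurable_reward.comp (measurable_pi_apply h)).const_mul _

/-- The expected return `J(π)`. -/
def expReturn (M : MDP S A) (π : Policy S A) (H : ℕ) : ℝ :=
  ∫ τ, M.ret τ ∂(M.trajLaw π H)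

/-- The optimality gap `J* - J(θ)`, with `J* = sup_θ J(θ)`. -/
def gap {Θ : Type*} (M : MDP S A) (π : Θ → Policy S A) (H : ℕ) (θ : Θ) : ℝ :=
  (⨆ θ' : Θ, M.expReturn (π θ') H) - M.expReturn (π θ) H

/-- The mediator feedback of `π`: the law of the pair (trajectory, return). -/
def feedbackLaw (M : MDP S A) (π : Policy S A) (H : ℕ) : Measure (Trajectory S A H × ℝ) :=
  (M.trajLaw π H).map fun τ => (τ, M.ret τ)

instance (M : MDP S A) (π : Policy S A) (H : ℕ) : IsProbabilityMeasure (M.feedbackLaw π H) := by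
  rw [feedbackLaw]
  exact Measure.isProbabilityMeasure_map (measurable_id.prodMk (M.measurable_ret H)).aemeasurable

end MDP

/-! ### Online policy optimization -/

section Online

variable {S A : Type*} [MeasurableSpace S] [MeasurableSpace A] {H : ℕ}
  {Θ : Type*} [MeasurableSpace Θ]

/-- What is recorded in one round: the parameter, the trajectory and its return. -/
abbrev Round (Θ S A : Type*) (H : ℕ) := Θ × (Trajectory S A H × ℝ)

/-- A (possibly randomized) algorithm with mediator feedback: in each round the next parameter is
drawn from a distribution that depends measurably on all the previous rounds. -/
structure Algorithm (Θ S A : Type*) [MeasurableSpace Θ] [MeasurableSpace S] [MeasurableSpace A]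
    (H : ℕ) where
  /-- the law of the parameter of round `t + 1` given the first `t` rounds -/
  select : (t : ℕ) → Kernel (Fin t → Round Θ S A H) Θ
  isMarkovKernel_select : ∀ t, IsMarkovKernel (select t)

attribute [instance] Algorithm.isMarkovKernel_select

variable [Countable Θ] [MeasurableSingletonClass Θ]

/-- The law of round `t + 1` given the first `t` rounds: the algorithm selects `θ`, the policy `π θ`
is run in `M`, and its trajectory and return are observed. -/
def roundKernel (M : MDP S A) (π : Θ → Policy S A) (alg : Algorithm Θ S A H) (t : ℕ) :
    Kernel (Fin t → Round Θ S A H) (Round Θ S A H) :=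
  alg.select t ⊗ₖ Kernel.prodMkLeft (Fin t → Round Θ S A H)
    (Kernel.ofFunOfCountable fun θ => M.feedbackLaw (π θ) H)

instance (M : MDP S A) (π : Θ → Policy S A) (alg : Algorithm Θ S A H) (t : ℕ) :
    IsMarkovKernel (roundKernel M π alg t) := by
  have : IsMarkovKernel (Kernel.ofFunOfCountable fun θ => M.feedbackLaw (π θ) H) :=
    ⟨fun θ => inferInstanceAs (IsProbabilityMeasure (M.feedbackLaw (π θ) H))⟩
  rw [roundKernel]; infer_instance

/-- The law of the history of the first `n` rounds of the interaction of `alg` with `M`. -/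
def historyLaw (M : MDP S A) (π : Θ → Policy S A) (alg : Algorithm Θ S A H) (n : ℕ) :
    Measure (Fin n → Round Θ S A H) :=
  seqLaw (roundKernel M π alg) n

instance (M : MDP S A) (π : Θ → Policy S A) (alg : Algorithm Θ S A H) (n : ℕ) :
    IsProbabilityMeasure (historyLaw M π alg n) := by
  rw [historyLaw]; infer_instance

/-- The expected cumulative regret of `alg` in `M` after `n` rounds. -/
def expRegret (M : MDP S A) (π : Θ → Policy S A) (alg : Algorithm Θ S A H) (n : ℕ) : ℝ :=
  ∫ h, ∑ t : Fin n, M.gap π H (h t).1 ∂(historyLaw M π alg n)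

end Online

end MediatorFeedback

end

open scoped ENNReal

noncomputable section

namespace MediatorFeedback

/-! ### Sequential laws: change of density and centred increments -/

section SeqLaw

variable {X : Type*} [MeasurableSpace X]

/-! Start in state `0`, move to `N(c a, 1)` after action `a`, and let the reward be the state, with
`c = Δ` or `c = -Δ`. The Gaussian policy then earns `c` on average and the Dirac policy earns `0`,
so the sign of `c` decides which is optimal. Playing `a = 0` reveals nothing about this sign: only
rounds with the Gaussian policy are informative. The divergences between the policies are infinite
because one action law is atomless and the other is an atom.

The histories in the two MDPs have likelihood ratio `exp ℓ`, where `ℓ` sums `2 c a s` over the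
rounds, `s` being the second state (`historyLaw_eq_withDensity`). Let `T` count the Gaussian rounds.
Under `-Δ` the mean of `ℓ` is `-4 Δ² x` with `x = E T` (`integral_logLikelihood`). The regrets are
`Δ x` under `-Δ` and `Δ y` under `Δ`, where `y` is the mean of `n - T` in the latter.
Bretagnolle–Huber (`bretagnolleHuber_integral`) gives `x + y ≥ (n / 2) exp (-4 Δ² x)`: few
informative rounds in one MDP force many wrong ones in the other. Bounding the exponential below by
its tangent line gives the logarithm. -/

theorem lintegral_seqLaw_zero (κ : (k : ℕ) → Kernel (Fin k → X) X) (f : (Fin 0 → X) → ℝ≥0∞) :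
    ∫⁻ h, f h ∂(seqLaw κ 0) = f Fin.elim0 := by
  rw [seqLaw, lintegral_dirac]

theorem lintegral_seqLaw_succ (κ : (k : ℕ) → Kernel (Fin k → X) X) [∀ k, IsMarkovKernel (κ k)]
    (n : ℕ) {f : (Fin (n + 1) → X) → ℝ≥0∞} (hf : Measurable f) :
    ∫⁻ h, f h ∂(seqLaw κ (n + 1)) =
      ∫⁻ h, ∫⁻ x, f (Fin.snoc (α := fun _ => X) h x) ∂(κ n h) ∂(seqLaw κ n) := by
  rw [seqLaw, lintegral_map hf (measurable_snoc n),
    Measure.lintegral_compProd (f := fun p : (Fin n → X) × X => f (Fin.snoc p.1 p.2))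
      (hf.comp (measurable_snoc n))]

/-- A change of density in every step multiplies up to a change of density of the sequence. -/
theorem seqLaw_eq_withDensity (κ η : (k : ℕ) → Kernel (Fin k → X) X)
    [∀ k, IsMarkovKernel (κ k)] [∀ k, IsMarkovKernel (η k)] {g : X → ℝ≥0∞} (hg : Measurable g)
    (h : ∀ k x, κ k x = (η k x).withDensity g) (n : ℕ) :
    seqLaw κ n = (seqLaw η n).withDensity fun x => ∏ i, g (x i) := by
  have hprod (n : ℕ) : Measurable fun x : Fin n → X => ∏ i, g (x i) :=
    Finset.measurable_prod _ fun i _ => hg.comp (measurable_pi_apply i)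
  induction n with
  | zero =>
    simp only [seqLaw, Finset.univ_eq_empty, Finset.prod_empty]
    exact withDensity_one.symm
  | succ n ih =>
    refine Measure.ext_of_lintegral _ fun f hf => ?_
    rw [lintegral_withDensity_eq_lintegral_mul _ (hprod _) hf,
      lintegral_seqLaw_succ η n ((hprod _).mul hf), lintegral_seqLaw_succ κ n hf, ih]
    have hs := hf.comp (measurable_snoc n)
    rw [lintegral_withDensity_eq_lintegral_mul _ (hprod _) (Measurable.lintegral_kernel_prod_right
      (f := fun a b => f (Fin.snoc (α := fun _ => X) a b)) hs)]
    refine lintegral_congr fun x => ?_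
    have hfx : Measurable fun y => f (Fin.snoc (α := fun _ => X) x y) :=
      hs.comp measurable_prodMk_left
    simp only [Pi.mul_apply, h n x, Fin.prod_univ_castSucc, Fin.snoc_castSucc, Fin.snoc_last]
    rw [lintegral_withDensity_eq_lintegral_mul _ hg hfx, ← lintegral_const_mul _ (hg.mul hfx)]
    simp [mul_assoc]

/-- A sum of increments that are conditionally centred and bounded in mean is centred. -/
theorem integral_sum_seqLaw_eq_zero (κ : (k : ℕ) → Kernel (Fin k → X) X)
    [∀ k, IsMarkovKernel (κ k)] {d : X → ℝ} (hd : Measurable d) {C : ℝ≥0∞} (hC : C ≠ ∞)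
    (hbound : ∀ k x, ∫⁻ y, ‖d y‖ₑ ∂(κ k x) ≤ C) (hzero : ∀ k x, ∫ y, d y ∂(κ k x) = 0) (n : ℕ) :
    Integrable (fun h => ∑ i, d (h i)) (seqLaw κ n) ∧ ∫ h, ∑ i, d (h i) ∂(seqLaw κ n) = 0 := by
  have hsum (n : ℕ) : Measurable fun x : Fin n → X => ∑ i, d (x i) :=
    Finset.measurable_sum _ fun i _ => hd.comp (measurable_pi_apply i)
  induction n with
  | zero => simp
  | succ n ih =>
    have h1 : Integrable (fun p : (Fin n → X) × X => ∑ i, d (p.1 i)) (seqLaw κ n ⊗ₘ κ n) := by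
      have := ih.1
      rw [← Measure.fst_compProd (seqLaw κ n) (κ n)] at this
      exact this.comp_measurable measurable_fst
    have h2 : Integrable (fun p : (Fin n → X) × X => d p.2) (seqLaw κ n ⊗ₘ κ n) := by
      refine ⟨(hd.comp measurable_snd).aestronglyMeasurable, ?_⟩
      rw [hasFiniteIntegral_iff_enorm,
        Measure.lintegral_compProd (f := fun p : (Fin n → X) × X => ‖d p.2‖ₑ)
          (hd.comp measurable_snd).enorm]
      -- The conditional bound is uniform in the past, so it survives integration over the past.
      refine (lintegral_mono (hbound n)).trans_lt ?_
      simpa using hC.lt_top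
    have hsnoc : (fun p : (Fin n → X) × X =>
        ∑ i, d ((Fin.snoc (α := fun _ => X) p.1 p.2 : Fin (n + 1) → X) i)) =
        fun p => ∑ i, d (p.1 i) + d p.2 := by
      funext p
      simp [Fin.sum_univ_castSucc]
    constructor
    · rw [seqLaw, integrable_map_measure (hsum _).aestronglyMeasurable
        (measurable_snoc n).aemeasurable, Function.comp_def, hsnoc]
      exact h1.add h2
    · rw [seqLaw, integral_map (measurable_snoc n).aemeasurable (hsum _).aestronglyMeasurable,
        hsnoc, integral_add h1 h2, Measure.integral_compProd h2, Measure.integral_compProd h1]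
      simp [hzero, ih.2]

end SeqLaw

/-! ### Gaussian tilt and second moment -/

/-- Gaussian laws with opposite means are related by an exponential tilt. -/
theorem gaussianReal_eq_withDensity_neg (m : ℝ) :
    gaussianReal m 1 =
      (gaussianReal (-m) 1).withDensity fun x => ENNReal.ofReal (Real.exp (2 * m * x)) := by
  rw [gaussianReal_of_var_ne_zero _ one_ne_zero, gaussianReal_of_var_ne_zero _ one_ne_zero,
    ← withDensity_mul _ (measurable_gaussianPDF _ _) (by fun_prop)]
  congr 1
  funext x
  simp only [Pi.mul_apply, gaussianPDF, gaussianPDFReal]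
  rw [← ENNReal.ofReal_mul (by positivity), mul_assoc _ (Real.exp _), ← Real.exp_add]
  -- What remains is the exponent identity `-(x - m)² / 2 = -(x + m)² / 2 + 2 m x`.
  congr 3
  norm_num
  ring

theorem integrable_sq_gaussianReal (m : ℝ) :
    Integrable (fun x : ℝ => x ^ 2) (gaussianReal m 1) :=
  (memLp_id_gaussianReal 2).integrable_sq

theorem integral_sq_gaussianReal (m : ℝ) : ∫ x, x ^ 2 ∂(gaussianReal m 1) = 1 + m ^ 2 := by
  have h := variance_eq_sub (μ := gaussianReal m 1) (X := id) (memLp_id_gaussianReal 2)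
  rw [variance_id_gaussianReal] at h
  simp only [id, Pi.pow_apply, integral_id_gaussianReal, NNReal.coe_one] at h
  linarith

/-! ### Bretagnolle–Huber inequality -/

/-- A pointwise form of the Bretagnolle–Huber inequality, linear in `ℓ` and `exp ℓ`. -/
theorem bretagnolleHuber_pointwise {n t : ℝ} (ht : 0 ≤ t) (htn : t ≤ n) (ℓ y : ℝ) :
    n * (Real.exp (2 * y) * ((1 + ℓ / 2 - y) - (1 + Real.exp ℓ) / 4)) ≤
      t + (n - t) * Real.exp ℓ := by
  have hu : Real.exp ℓ = Real.exp (ℓ / 2) ^ 2 := by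
    rw [← Real.exp_nat_mul]; congr 1; push_cast; ring
  have hs : Real.exp (2 * y) = Real.exp y ^ 2 := by
    rw [← Real.exp_nat_mul]; norm_num
  -- The tangent to `exp` at `y`, evaluated at `ℓ / 2`; after integration it plays the role of
  -- Jensen's inequality.
  have hle : Real.exp y * (1 + ℓ / 2 - y) ≤ Real.exp (ℓ / 2) := by
    have h := mul_le_mul_of_nonneg_left (Real.add_one_le_exp (ℓ / 2 - y)) (Real.exp_pos y).le
    rw [← Real.exp_add] at h
    calc _ = Real.exp y * (ℓ / 2 - y + 1) := by ring
      _ ≤ _ := h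
      _ = _ := by congr 1; ring
  rw [hu, hs]
  have hs0 := Real.exp_pos y
  generalize Real.exp (ℓ / 2) = u at *
  generalize Real.exp y = s at *
  set b := s ^ 2 * ((1 + ℓ / 2 - y) - (1 + u ^ 2) / 4) with hb
  have hb0 : b ≤ s * u - s ^ 2 * (1 + u ^ 2) / 4 := by
    have := mul_le_mul_of_nonneg_left hle hs0.le
    rw [hb]
    linarith
  -- This bound and the next give `b ≤ min 1 (u ^ 2)`, a linearized Cauchy–Schwarz: complete the
  -- square in `s u - s² u² / 4 ≤ 1` and in `s u - s² / 4 ≤ u²`.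
  have hb1 : b ≤ 1 := by nlinarith [sq_nonneg (1 - s * u / 2), sq_nonneg s]
  have hb2 : b ≤ u ^ 2 := by nlinarith [sq_nonneg (u - s / 2), sq_nonneg (s * u)]
  calc n * b = t * b + (n - t) * b := by ring
    _ ≤ t * 1 + (n - t) * u ^ 2 :=
      add_le_add (mul_le_mul_of_nonneg_left hb1 ht)
        (mul_le_mul_of_nonneg_left hb2 (sub_nonneg.2 htn))
    _ = _ := by rw [mul_one]

/-- An integrated Bretagnolle–Huber inequality: `exp ℓ` is the density of a second probability
measure, and `t` a count between `0` and `n`. -/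
theorem bretagnolleHuber_integral {Ω : Type*} [MeasurableSpace Ω] (P : Measure Ω)
    [IsProbabilityMeasure P] {n : ℝ} {t ℓ : Ω → ℝ} (ht : ∀ ω, 0 ≤ t ω) (htn : ∀ ω, t ω ≤ n)
    (htm : Measurable t) (hℓ : Integrable ℓ P) (hexp : Integrable (fun ω => Real.exp (ℓ ω)) P)
    (hone : ∫ ω, Real.exp (ℓ ω) ∂P = 1) :
    n / 2 * Real.exp (∫ ω, ℓ ω ∂P) ≤
      ∫ ω, t ω ∂P + ∫ ω, (n - t ω) * Real.exp (ℓ ω) ∂P := by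
  have ht' : Integrable t P := .of_bound htm.aestronglyMeasurable n <| .of_forall fun ω => by
    rw [Real.norm_of_nonneg (ht ω)]; exact htn ω
  have hte : Integrable (fun ω => (n - t ω) * Real.exp (ℓ ω)) P :=
    hexp.bdd_mul (c := n) (by fun_prop) <| .of_forall fun ω => by
      rw [Real.norm_of_nonneg (sub_nonneg.2 (htn ω))]; linarith [ht ω]
  -- With `y` half the mean of `ℓ`, the term `ℓ / 2 - y` integrates to `0`, and `(1 + exp ℓ) / 4` to
  -- `1 / 2`; hence the factor `n / 2`.
  obtain ⟨y, hy⟩ : ∃ y, y = (∫ ω, ℓ ω ∂P) / 2 := ⟨_, rfl⟩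
  have hA : Integrable (fun ω => 1 + ℓ ω / 2 - y) P :=
    ((integrable_const _).add (hℓ.div_const 2)).sub (integrable_const _)
  have hB : Integrable (fun ω => (1 + Real.exp (ℓ ω)) / 4) P :=
    ((integrable_const _).add hexp).div_const 4
  rw [← integral_add ht' hte]
  refine le_trans (le_of_eq ?_) (integral_mono (((hA.sub hB).const_mul _).const_mul n)
    (ht'.add hte) fun ω => bretagnolleHuber_pointwise (ht ω) (htn ω) (ℓ ω) y)
  simp only [Pi.sub_apply]
  rw [integral_const_mul, integral_const_mul, integral_sub hA hB,
    integral_sub (f := fun ω => 1 + ℓ ω / 2) ((integrable_const _).add (hℓ.div_const 2))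
      (integrable_const _),
    integral_add (integrable_const _) (hℓ.div_const 2), integral_div, integral_div,
    integral_add (integrable_const _) hexp, hone]
  simp only [integral_const, probReal_univ, smul_eq_mul, one_mul]
  rw [show ∫ ω, ℓ ω ∂P = 2 * y by rw [hy]; ring]
  ring

/-! ### The Gaussian MDP and its trajectories of length two -/

section GaussianMDP

/-- The transition model in which the next state is Gaussian with mean `c` times the action. -/
def gaussianTrans (c : ℝ) : Kernel (ℝ × ℝ) ℝ where
  toFun p := gaussianReal (c * p.2) 1
  measurable' := measurable_gaussianReal.comp
    ((measurable_snd.const_mul c).prodMk (measurable_const (a := (1 : NNReal))))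

instance (c : ℝ) : IsMarkovKernel (gaussianTrans c) :=
  ⟨fun _ => inferInstanceAs (IsProbabilityMeasure (gaussianReal _ 1))⟩

/-- The undiscounted process started in `0`, with transitions `gaussianTrans c`, in which the reward
of a state is the state itself. -/
def gaussianMDP (c : ℝ) : MDP ℝ ℝ where
  trans := gaussianTrans c
  isMarkovKernel_trans := inferInstance
  reward := Prod.fst
  measurable_reward := measurable_fst
  discount := 1
  discount_mem := by simp
  init := Measure.dirac 0
  isProbabilityMeasure_init := inferInstance

/-- The policy whose actions are drawn from `α` in every state. -/
def constPolicy (α : Measure ℝ) [IsProbabilityMeasure α] : Policy ℝ ℝ where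
  act := Kernel.const ℝ α
  isMarkovKernel_act := inferInstance

variable (c : ℝ) (α : Measure ℝ) [IsProbabilityMeasure α]

theorem gaussianMDP_ret (τ : Trajectory ℝ ℝ 2) : (gaussianMDP c).ret τ = (τ 0).1 + (τ 1).1 := by
  simp [MDP.ret, gaussianMDP]

/-- The trajectory of length two with initial state `0`, actions `a` and `b`, and second state `s`. -/
def twoStep (a s b : ℝ) : Trajectory ℝ ℝ 2 := ![(0, a), (s, b)]

theorem measurable_twoStep : Measurable fun p : ℝ × ℝ × ℝ => twoStep p.1 p.2.1 p.2.2 := by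
  refine measurable_pi_lambda _ fun i => ?_
  fin_cases i <;> simp [twoStep] <;> fun_prop

theorem lintegral_trajLaw {f : Trajectory ℝ ℝ 2 → ℝ≥0∞} (hf : Measurable f) :
    ∫⁻ τ, f τ ∂((gaussianMDP c).trajLaw (constPolicy α) 2) =
      ∫⁻ a, ∫⁻ s, ∫⁻ b, f (twoStep a s b) ∂α ∂(gaussianReal (c * a) 1) ∂α := by
  have hstep0 (h : Trajectory ℝ ℝ 0) {g : ℝ × ℝ → ℝ≥0∞} (hg : Measurable g) :
      ∫⁻ x, g x ∂((gaussianMDP c).stepKernel (constPolicy α) 0 h) = ∫⁻ a, g (0, a) ∂α := by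
    rw [MDP.stepKernel, Kernel.lintegral_compProd _ _ _ hg]
    change ∫⁻ s, ∫⁻ a, g (s, a) ∂α ∂(Measure.dirac 0) = _
    rw [lintegral_dirac' _ (by fun_prop)]
  have hstep1 (h : Trajectory ℝ ℝ 1) {g : ℝ × ℝ → ℝ≥0∞} (hg : Measurable g) :
      ∫⁻ x, g x ∂((gaussianMDP c).stepKernel (constPolicy α) 1 h) =
        ∫⁻ s, ∫⁻ b, g (s, b) ∂α ∂(gaussianReal (c * (h 0).2) 1) := by
    rw [MDP.stepKernel, Kernel.lintegral_compProd _ _ _ hg]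
    rfl
  rw [MDP.trajLaw, lintegral_seqLaw_succ _ _ hf]
  have hfs := hf.comp (measurable_snoc (X := ℝ × ℝ) 1)
  rw [lintegral_seqLaw_succ _ _ (Measurable.lintegral_kernel_prod_right
      (f := fun a b => f (Fin.snoc (α := fun _ => ℝ × ℝ) a b)) hfs),
    lintegral_seqLaw_zero]
  have hin (h : Fin 1 → ℝ × ℝ) := hstep1 h (g := fun x => f (Fin.snoc (α := fun _ => ℝ × ℝ) h x))
    (hfs.comp measurable_prodMk_left)
  have hm := (Measurable.lintegral_kernel_prod_right
      (κ := (gaussianMDP c).stepKernel (constPolicy α) 1)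
      (f := fun a b => f (Fin.snoc (α := fun _ => ℝ × ℝ) a b)) hfs).comp
    ((measurable_snoc (X := ℝ × ℝ) 0).comp (measurable_prodMk_left (x := Fin.elim0)))
  refine (hstep0 _ hm).trans (lintegral_congr fun a => ?_)
  refine (hin _).trans (lintegral_congr fun s => lintegral_congr fun b => ?_)
  congr 1
  funext i
  fin_cases i <;> rfl

/-- The joint law of the first action and the second state. -/
theorem map_trajLaw :
    ((gaussianMDP c).trajLaw (constPolicy α) 2).map (fun τ => ((τ 0).2, (τ 1).1)) =
      (α.prod (gaussianReal 0 1)).map fun p => (p.1, c * p.1 + p.2) := by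
  refine Measure.ext_of_lintegral _ fun f hf => ?_
  rw [lintegral_map hf (by fun_prop : Measurable fun τ : Trajectory ℝ ℝ 2 => ((τ 0).2, (τ 1).1)),
    lintegral_map hf (by fun_prop : Measurable fun p : ℝ × ℝ => (p.1, c * p.1 + p.2)),
    lintegral_trajLaw c α (f := fun τ => f ((τ 0).2, (τ 1).1)) (by fun_prop),
    lintegral_prod (fun p => f (p.1, c * p.1 + p.2)) (by fun_prop)]
  refine lintegral_congr fun a => ?_
  -- Given the action `a`, the second state is standard noise shifted by `c * a`.
  have h := gaussianReal_map_const_add (μ := 0) (v := 1) (c * a)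
  rw [zero_add] at h
  simp only [twoStep, Matrix.cons_val_zero, Matrix.cons_val_one, lintegral_const, measure_univ,
    mul_one]
  rw [← h, lintegral_map (by fun_prop) (by fun_prop)]

/-- The first state is `0` almost surely. -/
theorem trajLaw_ae_fst_eq_zero :
    ∀ᵐ τ ∂((gaussianMDP c).trajLaw (constPolicy α) 2), (τ 0).1 = 0 := by
  have hs : MeasurableSet {τ : Trajectory ℝ ℝ 2 | (τ 0).1 = 0}ᶜ :=
    (measurableSet_eq_fun (by fun_prop) measurable_const).compl
  rw [ae_iff]
  change (gaussianMDP c).trajLaw (constPolicy α) 2 {τ : Trajectory ℝ ℝ 2 | (τ 0).1 = 0}ᶜ = 0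
  rw [← lintegral_indicator_one hs, lintegral_trajLaw _ _ (measurable_one.indicator hs)]
  simp [twoStep]

theorem map_trajLaw_action :
    ((gaussianMDP c).trajLaw (constPolicy α) 2).map (fun τ => (τ 0).2) = α := by
  have h := congrArg (Measure.map Prod.fst) (map_trajLaw c α)
  rw [Measure.map_map (by fun_prop) (by fun_prop), Measure.map_map (by fun_prop) (by fun_prop)] at h
  refine h.trans ?_
  change (α.prod (gaussianReal 0 1)).map Prod.fst = α
  simp

theorem ae_eq_ret : (gaussianMDP c).ret =ᵐ[(gaussianMDP c).trajLaw (constPolicy α) 2]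
    fun τ => (τ 1).1 := by
  filter_upwards [trajLaw_ae_fst_eq_zero c α] with τ hτ
  rw [gaussianMDP_ret, hτ, zero_add]

variable {c α}

theorem integrable_trajLaw_iff {f : ℝ × ℝ → ℝ} (hf : Measurable f) :
    Integrable (fun τ => f ((τ 0).2, (τ 1).1)) ((gaussianMDP c).trajLaw (constPolicy α) 2) ↔
      Integrable (fun p => f (p.1, c * p.1 + p.2)) (α.prod (gaussianReal 0 1)) := by
  have h1 := integrable_map_measure (μ := (gaussianMDP c).trajLaw (constPolicy α) 2)
    (f := fun τ => ((τ 0).2, (τ 1).1)) hf.aestronglyMeasurable (by fun_prop)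
  have h2 := integrable_map_measure (μ := α.prod (gaussianReal 0 1))
    (f := fun p => (p.1, c * p.1 + p.2)) hf.aestronglyMeasurable (by fun_prop)
  rw [map_trajLaw] at h1
  exact h1.symm.trans h2

theorem integral_trajLaw {f : ℝ × ℝ → ℝ} (hf : Measurable f) :
    ∫ τ, f ((τ 0).2, (τ 1).1) ∂((gaussianMDP c).trajLaw (constPolicy α) 2) =
      ∫ p, f (p.1, c * p.1 + p.2) ∂(α.prod (gaussianReal 0 1)) := by
  rw [← integral_map (φ := fun τ : Trajectory ℝ ℝ 2 => ((τ 0).2, (τ 1).1)) (by fun_prop)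
    hf.aestronglyMeasurable, map_trajLaw, integral_map (by fun_prop) hf.aestronglyMeasurable]

theorem integrable_id_gaussianReal (m : ℝ) : Integrable (fun x : ℝ => x) (gaussianReal m 1) :=
  (memLp_id_gaussianReal 1).integrable le_rfl

theorem integrable_ret (hα : Integrable (fun a => a) α) :
    Integrable (gaussianMDP c).ret ((gaussianMDP c).trajLaw (constPolicy α) 2) := by
  rw [integrable_congr (ae_eq_ret c α)]
  refine (integrable_trajLaw_iff (f := Prod.snd) measurable_snd).2 ?_
  exact (hα.comp_fst _ |>.const_mul c).add ((integrable_id_gaussianReal 0).comp_snd _)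

theorem expReturn_gaussianMDP (hα : Integrable (fun a => a) α) :
    (gaussianMDP c).expReturn (constPolicy α) 2 = c * ∫ a, a ∂α := by
  rw [MDP.expReturn, integral_congr_ae (ae_eq_ret c α)]
  refine (integral_trajLaw (f := Prod.snd) measurable_snd).trans ?_
  rw [integral_add (hα.comp_fst _ |>.const_mul c) ((integrable_id_gaussianReal 0).comp_snd _),
    integral_const_mul, integral_fun_fst (fun a => a), integral_fun_snd fun b => b]
  simp

theorem integrable_mul_trajLaw (hα : Integrable (fun a => a) α) (hα2 : Integrable (fun a => a ^ 2) α) :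
    Integrable (fun τ => (τ 0).2 * (τ 1).1) ((gaussianMDP c).trajLaw (constPolicy α) 2) := by
  refine (integrable_trajLaw_iff (f := fun p => p.1 * p.2) (by fun_prop)).2 ?_
  refine ((hα2.comp_fst _ |>.const_mul c).add
    (hα.mul_prod (integrable_id_gaussianReal 0))).congr (.of_forall fun p => ?_)
  simp only [Pi.add_apply]
  ring

theorem integral_mul_trajLaw (hα : Integrable (fun a => a) α) (hα2 : Integrable (fun a => a ^ 2) α) :
    ∫ τ, (τ 0).2 * (τ 1).1 ∂((gaussianMDP c).trajLaw (constPolicy α) 2) = c * ∫ a, a ^ 2 ∂α := by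
  refine (integral_trajLaw (f := fun p => p.1 * p.2) (by fun_prop)).trans ?_
  have h : (fun p : ℝ × ℝ => p.1 * (c * p.1 + p.2)) = fun p => c * p.1 ^ 2 + p.1 * p.2 := by
    funext p; ring
  rw [h, integral_add (hα2.comp_fst _ |>.const_mul c) (hα.mul_prod (integrable_id_gaussianReal 0)),
    integral_const_mul, integral_fun_fst (fun a => a ^ 2),
    integral_prod_mul (fun a => a) fun b => b]
  simp

/-- Absolute continuity passes to image measures, here to the law of the first action. -/
theorem absolutelyContinuous_of_trajLaw {β : Measure ℝ} [IsProbabilityMeasure β]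
    (h : (gaussianMDP c).trajLaw (constPolicy α) 2 ≪ (gaussianMDP c).trajLaw (constPolicy β) 2) :
    α ≪ β := by
  have := h.map (f := fun τ => (τ 0).2) (by fun_prop)
  rwa [map_trajLaw_action, map_trajLaw_action] at this

variable (c α) in
/-- Opposite transition models give trajectory laws related by an exponential tilt. -/
theorem trajLaw_eq_withDensity :
    (gaussianMDP c).trajLaw (constPolicy α) 2 =
      ((gaussianMDP (-c)).trajLaw (constPolicy α) 2).withDensity
        fun τ => ENNReal.ofReal (Real.exp (2 * c * ((τ 0).2 * (τ 1).1))) := by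
  refine Measure.ext_of_lintegral _ fun f hf => ?_
  rw [lintegral_withDensity_eq_lintegral_mul _ (by fun_prop) hf,
    lintegral_trajLaw _ _ (.mul (by fun_prop) hf), lintegral_trajLaw _ _ hf]
  refine lintegral_congr fun a => ?_
  have hm : Measurable fun p : ℝ × ℝ => f (twoStep a p.1 p.2) :=
    hf.comp (measurable_twoStep.comp measurable_prodMk_left)
  rw [gaussianReal_eq_withDensity_neg, lintegral_withDensity_eq_lintegral_mul _ (by fun_prop)
    hm.lintegral_prod_right', neg_mul]
  refine lintegral_congr fun s => ?_
  simp only [Pi.mul_apply]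
  have hms : Measurable fun b => f (twoStep a s b) :=
    hm.comp (measurable_prodMk_left (x := s))
  rw [← lintegral_const_mul _ hms]
  simp [twoStep, mul_assoc]

end GaussianMDP

/-! ### One round of interaction -/

section Round

variable {S A : Type*} [MeasurableSpace S] [MeasurableSpace A] {H : ℕ}
  {Θ : Type*} [MeasurableSpace Θ] [Countable Θ] [MeasurableSingletonClass Θ]

theorem lintegral_roundKernel (M : MDP S A) (π : Θ → Policy S A) (alg : Algorithm Θ S A H)
    (t : ℕ) (h : Fin t → Round Θ S A H) {f : Round Θ S A H → ℝ≥0∞} (hf : Measurable f) :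
    ∫⁻ r, f r ∂(roundKernel M π alg t h) =
      ∫⁻ θ, ∫⁻ τ, f (θ, (τ, M.ret τ)) ∂(M.trajLaw (π θ) H) ∂(alg.select t h) := by
  have : IsMarkovKernel (Kernel.ofFunOfCountable fun θ => M.feedbackLaw (π θ) H) :=
    ⟨fun θ => inferInstanceAs (IsProbabilityMeasure (M.feedbackLaw (π θ) H))⟩
  rw [roundKernel, Kernel.lintegral_compProd _ _ _ hf]
  refine lintegral_congr fun θ => ?_
  change ∫⁻ y, f (θ, y) ∂(M.feedbackLaw (π θ) H) = _
  exact lintegral_map (hf.comp measurable_prodMk_left) (measurable_id.prodMk (M.measurable_ret H))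

theorem integral_roundKernel (M : MDP S A) (π : Θ → Policy S A) (alg : Algorithm Θ S A H)
    (t : ℕ) (h : Fin t → Round Θ S A H) {f : Round Θ S A H → ℝ} (hf : Measurable f)
    (hi : Integrable f (roundKernel M π alg t h)) :
    ∫ r, f r ∂(roundKernel M π alg t h) =
      ∫ θ, ∫ τ, f (θ, (τ, M.ret τ)) ∂(M.trajLaw (π θ) H) ∂(alg.select t h) := by
  have : IsMarkovKernel (Kernel.ofFunOfCountable fun θ => M.feedbackLaw (π θ) H) :=
    ⟨fun θ => inferInstanceAs (IsProbabilityMeasure (M.feedbackLaw (π θ) H))⟩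
  rw [roundKernel] at hi ⊢
  rw [integral_compProd hi]
  refine integral_congr_ae (.of_forall fun θ => ?_)
  change ∫ y, f (θ, y) ∂(M.feedbackLaw (π θ) H) = _
  exact integral_map (measurable_id.prodMk (M.measurable_ret H)).aemeasurable
    (hf.comp measurable_prodMk_left).aestronglyMeasurable

/-- The selection rule is common to both MDPs and contributes no density. The recorded return is the
same function of the trajectory in both, so it adds no information either. -/
theorem roundKernel_eq_withDensity {M N : MDP S A} {π : Θ → Policy S A}
    (hret : (M.ret : Trajectory S A H → ℝ) = N.ret) {g : Trajectory S A H → ℝ≥0∞}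
    (hg : Measurable g)
    (h : ∀ θ, M.trajLaw (π θ) H = (N.trajLaw (π θ) H).withDensity g) (alg : Algorithm Θ S A H)
    (t : ℕ) (x : Fin t → Round Θ S A H) :
    roundKernel M π alg t x = (roundKernel N π alg t x).withDensity fun r => g r.2.1 := by
  have hg' : Measurable fun r : Round Θ S A H => g r.2.1 := by fun_prop
  refine Measure.ext_of_lintegral _ fun f hf => ?_
  rw [lintegral_withDensity_eq_lintegral_mul _ hg' hf, lintegral_roundKernel _ _ _ _ _ hf,
    lintegral_roundKernel _ _ _ _ _ (hg'.mul hf)]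
  refine lintegral_congr fun θ => ?_
  have hm : Measurable fun τ => f (θ, (τ, N.ret τ)) :=
    hf.comp (measurable_const.prodMk (measurable_id.prodMk (N.measurable_ret H)))
  rw [h θ, hret, lintegral_withDensity_eq_lintegral_mul _ hg hm]
  rfl

end Round

/-- Finiteness of `Θ` bounds the range, so that the real supremum is genuine and not a default
value. -/
theorem MDP.gap_eq {S A : Type*} [MeasurableSpace S] [MeasurableSpace A] {H : ℕ} {Θ : Type*}
    [Finite Θ] (M : MDP S A) (π : Θ → Policy S A) {θ₀ : Θ}
    (h : ∀ θ, M.expReturn (π θ) H ≤ M.expReturn (π θ₀) H) (θ : Θ) :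
    M.gap π H θ = M.expReturn (π θ₀) H - M.expReturn (π θ) H := by
  have : Nonempty Θ := ⟨θ₀⟩
  rw [MDP.gap, le_antisymm (ciSup_le h) (le_ciSup (f := fun θ => M.expReturn (π θ) H)
    (Set.finite_range _).bddAbove θ₀)]

/-! ### The two policies: returns and infinite divergences -/

/-- A Gaussian and a deterministic policy. -/
def gaussianDiracPolicy : Fin 2 → Policy ℝ ℝ :=
  ![constPolicy (gaussianReal 1 1), constPolicy (Measure.dirac 0)]

theorem gaussianDiracPolicy_zero :
    gaussianDiracPolicy 0 = constPolicy (gaussianReal 1 1) := rfl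

theorem gaussianDiracPolicy_one :
    gaussianDiracPolicy 1 = constPolicy (Measure.dirac 0) := rfl

theorem expReturn_zero (c : ℝ) : (gaussianMDP c).expReturn (gaussianDiracPolicy 0) 2 = c := by
  rw [gaussianDiracPolicy_zero, expReturn_gaussianMDP (integrable_id_gaussianReal 1),
    integral_id_gaussianReal, mul_one]

theorem expReturn_one (c : ℝ) : (gaussianMDP c).expReturn (gaussianDiracPolicy 1) 2 = 0 := by
  rw [gaussianDiracPolicy_one, expReturn_gaussianMDP (integrable_dirac (by simp)),
    integral_dirac, mul_zero]

theorem integrable_ret_gaussianDiracPolicy (c : ℝ) (θ : Fin 2) :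
    Integrable (gaussianMDP c).ret ((gaussianMDP c).trajLaw (gaussianDiracPolicy θ) 2) := by
  fin_cases θ
  · exact integrable_ret (integrable_id_gaussianReal 1)
  · exact integrable_ret (integrable_dirac (by simp))

theorem not_gaussianReal_absolutelyContinuous_dirac :
    ¬ gaussianReal 1 1 ≪ Measure.dirac (0 : ℝ) := fun h => by
  have := nullSingletonClass_gaussianReal (μ := 1) (v := 1) one_ne_zero
  have h0 : gaussianReal 1 1 {(0 : ℝ)}ᶜ = 0 := h (by simp)
  rw [prob_compl_eq_zero_iff (measurableSet_singleton 0), measure_singleton] at h0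
  exact zero_ne_one h0

theorem not_dirac_absolutelyContinuous_gaussianReal :
    ¬ Measure.dirac (0 : ℝ) ≪ gaussianReal 1 1 := fun h => by
  have := nullSingletonClass_gaussianReal (μ := 1) (v := 1) one_ne_zero
  have h0 : Measure.dirac (0 : ℝ) {(0 : ℝ)} = 0 := h (measure_singleton 0)
  simp at h0

theorem klDiv_trajLaw_eq_top (c : ℝ) :
    InformationTheory.klDiv ((gaussianMDP c).trajLaw (gaussianDiracPolicy 0) 2)
        ((gaussianMDP c).trajLaw (gaussianDiracPolicy 1) 2) = ⊤ ∧
      InformationTheory.klDiv ((gaussianMDP c).trajLaw (gaussianDiracPolicy 1) 2)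
        ((gaussianMDP c).trajLaw (gaussianDiracPolicy 0) 2) = ⊤ :=
  ⟨InformationTheory.klDiv_of_not_ac fun h =>
      not_gaussianReal_absolutelyContinuous_dirac (absolutelyContinuous_of_trajLaw h),
    InformationTheory.klDiv_of_not_ac fun h =>
      not_dirac_absolutelyContinuous_gaussianReal (absolutelyContinuous_of_trajLaw h)⟩

/-- The product of the first action and the second state. -/
def actionState (τ : Trajectory ℝ ℝ 2) : ℝ := (τ 0).2 * (τ 1).1

@[fun_prop]
theorem measurable_actionState : Measurable actionState := by
  unfold actionState; fun_prop

theorem integrable_actionState (c : ℝ) (θ : Fin 2) :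
    Integrable actionState ((gaussianMDP c).trajLaw (gaussianDiracPolicy θ) 2) := by
  fin_cases θ
  · exact integrable_mul_trajLaw (integrable_id_gaussianReal 1) (integrable_sq_gaussianReal 1)
  · exact integrable_mul_trajLaw (integrable_dirac (by simp)) (integrable_dirac (by simp))

/-- The mean is `c` times the second moment of the action, which is `1 + 1 = 2` for `N(1, 1)` and
`0` for the Dirac law. -/
theorem integral_actionState (c : ℝ) (θ : Fin 2) :
    ∫ τ, actionState τ ∂((gaussianMDP c).trajLaw (gaussianDiracPolicy θ) 2) =
      if θ = 0 then 2 * c else 0 := by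
  fin_cases θ
  · refine (integral_mul_trajLaw (integrable_id_gaussianReal 1)
      (integrable_sq_gaussianReal 1)).trans ?_
    rw [integral_sq_gaussianReal]
    norm_num
    ring
  · refine (integral_mul_trajLaw (integrable_dirac (by simp)) (integrable_dirac (by simp))).trans ?_
    simp

/-! ### Likelihood ratio of histories -/

/-- The number of rounds in which the Gaussian policy has been selected. -/
def gaussianCount {n : ℕ} (h : Fin n → Round (Fin 2) ℝ ℝ 2) : ℝ :=
  ∑ i, if (h i).1 = 0 then 1 else 0

theorem measurable_ite_fst_eq_zero :
    Measurable fun r : Round (Fin 2) ℝ ℝ 2 => if r.1 = 0 then (1 : ℝ) else 0 :=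
  (measurable_of_countable fun θ : Fin 2 => if θ = 0 then (1 : ℝ) else 0).comp measurable_fst

theorem measurable_gaussianCount (n : ℕ) :
    Measurable (gaussianCount : (Fin n → Round (Fin 2) ℝ ℝ 2) → ℝ) :=
  Finset.measurable_sum _ fun i _ => measurable_ite_fst_eq_zero.comp (measurable_pi_apply i)

theorem gaussianCount_nonneg {n : ℕ} (h : Fin n → Round (Fin 2) ℝ ℝ 2) : 0 ≤ gaussianCount h :=
  Finset.sum_nonneg fun i _ => by split_ifs <;> norm_num

theorem gaussianCount_le {n : ℕ} (h : Fin n → Round (Fin 2) ℝ ℝ 2) : gaussianCount h ≤ n := by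
  refine (Finset.sum_le_card_nsmul _ _ 1 fun i _ => ?_).trans (by simp)
  split_ifs <;> norm_num

/-- The log-likelihood ratio of the histories in `gaussianMDP c` and `gaussianMDP (-c)`. -/
def logLikelihood (c : ℝ) {n : ℕ} (h : Fin n → Round (Fin 2) ℝ ℝ 2) : ℝ :=
  ∑ i, 2 * c * actionState (h i).2.1

theorem measurable_logLikelihood (c : ℝ) (n : ℕ) :
    Measurable (logLikelihood c : (Fin n → Round (Fin 2) ℝ ℝ 2) → ℝ) := by
  unfold logLikelihood; fun_prop

variable (c : ℝ) (alg : Algorithm (Fin 2) ℝ ℝ 2) (n : ℕ)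

theorem trajLaw_gaussianDiracPolicy_eq_withDensity (θ : Fin 2) :
    (gaussianMDP c).trajLaw (gaussianDiracPolicy θ) 2 =
      ((gaussianMDP (-c)).trajLaw (gaussianDiracPolicy θ) 2).withDensity
        fun τ => ENNReal.ofReal (Real.exp (2 * c * actionState τ)) := by
  fin_cases θ
  · exact trajLaw_eq_withDensity c (gaussianReal 1 1)
  · exact trajLaw_eq_withDensity c (Measure.dirac 0)

theorem historyLaw_eq_withDensity :
    historyLaw (gaussianMDP c) gaussianDiracPolicy alg n =
      (historyLaw (gaussianMDP (-c)) gaussianDiracPolicy alg n).withDensity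
        fun h => ENNReal.ofReal (Real.exp (logLikelihood c h)) := by
  have hg : Measurable fun τ => ENNReal.ofReal (Real.exp (2 * c * actionState τ)) := by fun_prop
  have hret : ((gaussianMDP c).ret : Trajectory ℝ ℝ 2 → ℝ) = (gaussianMDP (-c)).ret := by
    funext τ
    rw [gaussianMDP_ret, gaussianMDP_ret]
  have hround := roundKernel_eq_withDensity hret hg
    (trajLaw_gaussianDiracPolicy_eq_withDensity c) alg
  have hg' : Measurable fun r : Round (Fin 2) ℝ ℝ 2 =>
      ENNReal.ofReal (Real.exp (2 * c * actionState r.2.1)) := by fun_prop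
  rw [historyLaw, historyLaw, seqLaw_eq_withDensity _ _ hg' hround n]
  congr 1
  funext h
  rw [logLikelihood, Real.exp_sum, ENNReal.ofReal_prod_of_nonneg fun _ _ => (Real.exp_pos _).le]

theorem integral_historyLaw (f : (Fin n → Round (Fin 2) ℝ ℝ 2) → ℝ) :
    ∫ h, f h ∂(historyLaw (gaussianMDP c) gaussianDiracPolicy alg n) =
      ∫ h, f h * Real.exp (logLikelihood c h)
        ∂(historyLaw (gaussianMDP (-c)) gaussianDiracPolicy alg n) := by
  have := measurable_logLikelihood c n
  rw [historyLaw_eq_withDensity, integral_withDensity_eq_integral_toReal_smul (by fun_prop)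
    (.of_forall fun _ => ENNReal.ofReal_lt_top)]
  refine integral_congr_ae (.of_forall fun h => ?_)
  simp only [ENNReal.toReal_ofReal (Real.exp_pos _).le, smul_eq_mul, mul_comm]

/-- As the density of a probability measure, this has total mass `1`; no exponential moment has to
be estimated. -/
theorem integrable_exp_logLikelihood :
    Integrable (fun h => Real.exp (logLikelihood c h))
      (historyLaw (gaussianMDP (-c)) gaussianDiracPolicy alg n) := by
  have := measurable_logLikelihood c n
  refine ⟨by fun_prop, ?_⟩
  rw [hasFiniteIntegral_iff_ofReal (.of_forall fun h => (Real.exp_pos _).le),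
    ← setLIntegral_univ, ← withDensity_apply _ .univ, ← historyLaw_eq_withDensity]
  simp

theorem integrable_gaussianCount (M : MDP ℝ ℝ) (π : Fin 2 → Policy ℝ ℝ) :
    Integrable gaussianCount (historyLaw M π alg n) :=
  .of_bound (measurable_gaussianCount n).aestronglyMeasurable n <| .of_forall fun h => by
    rw [Real.norm_of_nonneg (gaussianCount_nonneg h)]
    exact gaussianCount_le h

/-- Under `gaussianMDP (-c)`, the log-likelihood ratio has drift `-4 * c ^ 2` whenever the Gaussian
policy is selected, and none otherwise. -/
theorem integral_logLikelihood :
    Integrable (logLikelihood c) (historyLaw (gaussianMDP (-c)) gaussianDiracPolicy alg n) ∧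
      ∫ h, logLikelihood c h ∂(historyLaw (gaussianMDP (-c)) gaussianDiracPolicy alg n) =
        -(4 * c ^ 2 * ∫ h, gaussianCount h
          ∂(historyLaw (gaussianMDP (-c)) gaussianDiracPolicy alg n)) := by
  -- The log-likelihood increment minus its conditional mean, `2 c * (-2 c)` on Gaussian rounds;
  -- this makes the sum centred whatever the algorithm selects.
  set d : Round (Fin 2) ℝ ℝ 2 → ℝ :=
    fun r => 2 * c * actionState r.2.1 + 4 * c ^ 2 * if r.1 = 0 then 1 else 0 with hd_def
  have hd : Measurable d := by
    have := measurable_ite_fst_eq_zero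
    fun_prop
  have hint (θ : Fin 2) : Integrable (fun τ => d (θ, (τ, (gaussianMDP (-c)).ret τ)))
      ((gaussianMDP (-c)).trajLaw (gaussianDiracPolicy θ) 2) :=
    ((integrable_actionState (-c) θ).const_mul _).add
      (integrable_const (4 * c ^ 2 * if θ = 0 then 1 else 0))
  have hintzero (θ : Fin 2) : ∫ τ, d (θ, (τ, (gaussianMDP (-c)).ret τ))
      ∂((gaussianMDP (-c)).trajLaw (gaussianDiracPolicy θ) 2) = 0 := by
    simp only [hd_def]
    rw [integral_add ((integrable_actionState (-c) θ).const_mul _) (integrable_const (4 * c ^ 2 * if θ = 0 then 1 else 0)),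
      integral_const_mul, integral_actionState, integral_const]
    split_ifs <;> simp
    ring
  -- The conditional first absolute moment averages `B` over the selected policy, so the sum of `B`
  -- over both policies bounds it uniformly in the history.
  set B : Fin 2 → ℝ≥0∞ := fun θ => ∫⁻ τ, ‖d (θ, (τ, (gaussianMDP (-c)).ret τ))‖ₑ
      ∂((gaussianMDP (-c)).trajLaw (gaussianDiracPolicy θ) 2)
  have hBfin : ∑ θ, B θ ≠ ∞ :=
    ENNReal.sum_ne_top.2 fun θ _ => (hasFiniteIntegral_iff_enorm.1 (hint θ).2).ne
  have hbound (k : ℕ) (x : Fin k → Round (Fin 2) ℝ ℝ 2) :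
      ∫⁻ r, ‖d r‖ₑ ∂(roundKernel (gaussianMDP (-c)) gaussianDiracPolicy alg k x) ≤ ∑ θ, B θ := by
    rw [lintegral_roundKernel _ _ _ _ _ hd.enorm]
    refine (lintegral_mono fun θ =>
      Finset.single_le_sum (f := B) (fun _ _ => zero_le) (Finset.mem_univ θ)).trans ?_
    simp
  have hzero (k : ℕ) (x : Fin k → Round (Fin 2) ℝ ℝ 2) :
      ∫ r, d r ∂(roundKernel (gaussianMDP (-c)) gaussianDiracPolicy alg k x) = 0 := by
    rw [integral_roundKernel _ _ _ _ _ hd ⟨hd.aestronglyMeasurable,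
      hasFiniteIntegral_iff_enorm.2 ((hbound k x).trans_lt hBfin.lt_top)⟩]
    simp [hintzero]
  obtain ⟨hi, h0⟩ := integral_sum_seqLaw_eq_zero _ hd hBfin hbound hzero n
  have hC := (integrable_gaussianCount alg n (gaussianMDP (-c)) gaussianDiracPolicy).const_mul
    (4 * c ^ 2)
  have hℓ : logLikelihood c = fun h : Fin n → Round (Fin 2) ℝ ℝ 2 =>
      ∑ i, d (h i) - 4 * c ^ 2 * gaussianCount h := by
    funext h
    simp only [hd_def, logLikelihood, gaussianCount, Finset.sum_add_distrib, Finset.mul_sum]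
    ring
  rw [hℓ]
  refine ⟨hi.sub hC, ?_⟩
  refine (integral_sub hi hC).trans ?_
  rw [h0, zero_sub, integral_const_mul]
  rfl

/-! ### Regret and the lower bound -/

theorem gap_pos {c : ℝ} (hc : 0 ≤ c) (θ : Fin 2) :
    (gaussianMDP c).gap gaussianDiracPolicy 2 θ = c * (1 - if θ = 0 then 1 else 0) := by
  rw [MDP.gap_eq (θ₀ := 0)]
  · fin_cases θ <;> simp [expReturn_zero, expReturn_one]
  · intro θ
    fin_cases θ <;> simp [expReturn_zero, expReturn_one, hc]

theorem gap_neg {c : ℝ} (hc : 0 ≤ c) (θ : Fin 2) :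
    (gaussianMDP (-c)).gap gaussianDiracPolicy 2 θ = c * if θ = 0 then 1 else 0 := by
  rw [MDP.gap_eq (θ₀ := 1)]
  · fin_cases θ <;> simp [expReturn_zero, expReturn_one]
  · intro θ
    fin_cases θ <;> simp [expReturn_zero, expReturn_one, hc]

/-- Regret here accrues on Dirac rounds; the change of measure moves it to the law under `-c`, where
both regrets can be compared. -/
theorem expRegret_pos {c : ℝ} (hc : 0 ≤ c) :
    expRegret (gaussianMDP c) gaussianDiracPolicy alg n =
      c * ∫ h, (n - gaussianCount h) * Real.exp (logLikelihood c h)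
        ∂(historyLaw (gaussianMDP (-c)) gaussianDiracPolicy alg n) := by
  rw [expRegret, ← integral_historyLaw c alg n fun h => n - gaussianCount h, ← integral_const_mul]
  simp [gap_pos hc, gaussianCount, ← Finset.mul_sum]

theorem expRegret_neg {c : ℝ} (hc : 0 ≤ c) :
    expRegret (gaussianMDP (-c)) gaussianDiracPolicy alg n =
      c * ∫ h, gaussianCount h
        ∂(historyLaw (gaussianMDP (-c)) gaussianDiracPolicy alg n) := by
  rw [expRegret, ← integral_const_mul]
  simp only [gap_neg hc, gaussianCount, Finset.mul_sum]

theorem log_le_max_expRegret {Δ : ℝ} (hΔ : 0 < Δ) (hn : 1 ≤ n) :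
    1 / (8 * Δ) * Real.log (Δ ^ 2 * n) ≤
      max (expRegret (gaussianMDP Δ) gaussianDiracPolicy alg n)
        (expRegret (gaussianMDP (-Δ)) gaussianDiracPolicy alg n) := by
  obtain ⟨hℓ, hℓ'⟩ := integral_logLikelihood Δ alg n
  have hone := integral_historyLaw Δ alg n fun _ => 1
  simp only [integral_const, probReal_univ, smul_eq_mul, one_mul] at hone
  have hBH := bretagnolleHuber_integral _ gaussianCount_nonneg gaussianCount_le
    (measurable_gaussianCount n) hℓ (integrable_exp_logLikelihood Δ alg n) hone.symm
  rw [hℓ'] at hBH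
  have hpos := expRegret_pos alg n hΔ.le
  have hneg := expRegret_neg alg n hΔ.le
  generalize ∫ h, gaussianCount h
    ∂(historyLaw (gaussianMDP (-Δ)) gaussianDiracPolicy alg n) = x at *
  generalize ∫ h, (n - gaussianCount h) * Real.exp (logLikelihood Δ h)
    ∂(historyLaw (gaussianMDP (-Δ)) gaussianDiracPolicy alg n) = y at *
  have hN : 0 < Δ ^ 2 * n := by positivity
  -- The factor `Δ² n` is absorbed into the exponent, so that `1 + z ≤ exp z` produces the
  -- logarithm.
  have hexp := Real.add_one_le_exp (Real.log (Δ ^ 2 * n) + -(4 * Δ ^ 2 * x))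
  rw [Real.exp_add, Real.exp_log hN] at hexp
  have h1 := le_max_left (expRegret (gaussianMDP Δ) gaussianDiracPolicy alg n)
    (expRegret (gaussianMDP (-Δ)) gaussianDiracPolicy alg n)
  have h2 := le_max_right (expRegret (gaussianMDP Δ) gaussianDiracPolicy alg n)
    (expRegret (gaussianMDP (-Δ)) gaussianDiracPolicy alg n)
  generalize max (expRegret (gaussianMDP Δ) gaussianDiracPolicy alg n)
    (expRegret (gaussianMDP (-Δ)) gaussianDiracPolicy alg n) = m at *
  rw [hpos] at h1
  rw [hneg] at h2
  rw [div_mul_eq_mul_div, one_mul, div_le_iff₀ (by positivity)]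
  have h3 : Δ ^ 2 * (n / 2 * Real.exp (-(4 * Δ ^ 2 * x))) ≤ Δ ^ 2 * (x + y) :=
    mul_le_mul_of_nonneg_left hBH (by positivity)
  have h4 := mul_le_mul_of_nonneg_left h1 hΔ.le
  have h5 := mul_le_mul_of_nonneg_left h2 hΔ.le
  -- Altogether `log (Δ² n) + 1 ≤ 2 Δ² (x + y) + 4 Δ² x = 6 Δ² x + 2 Δ² y ≤ 8 Δ m`, which is where
  -- the `8` comes from.
  linarith

end MediatorFeedback

end

theorem theorem2 (Δ : ℝ) (hΔ : 0 < Δ) :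
    ∃ (ν₁ ν₂ : MediatorFeedback.MDP ℝ ℝ) (π : Fin 2 → MediatorFeedback.Policy ℝ ℝ),
      -- the two policies: Gaussian and Dirac action distributions
      (∀ s, (π 0).act s = gaussianReal 1 1) ∧
      (∀ s, (π 1).act s = Measure.dirac 0) ∧
      -- the two MDPs differ only in the transition model
      ν₁.init = ν₂.init ∧ ν₁.reward = ν₂.reward ∧ ν₁.discount = ν₂.discount ∧
      -- in each of them the trajectory distributions have infinite divergence, both ways
      (∀ ν ∈ ({ν₁, ν₂} : Set (MediatorFeedback.MDP ℝ ℝ)),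
        InformationTheory.klDiv (ν.trajLaw (π 0) 2) (ν.trajLaw (π 1) 2) = ⊤ ∧
        InformationTheory.klDiv (ν.trajLaw (π 1) 2) (ν.trajLaw (π 0) 2) = ⊤ ∧
        ∀ θ, Integrable ν.ret (ν.trajLaw (π θ) 2)) ∧
      -- the gap is `Δ` in both, with opposite optimal policies
      ν₁.expReturn (π 0) 2 - ν₁.expReturn (π 1) 2 = Δ ∧
      ν₂.expReturn (π 1) 2 - ν₂.expReturn (π 0) 2 = Δ ∧
      -- every algorithm suffers logarithmic regret in at least one of them
      ∀ (n : ℕ), 1 ≤ n → ∀ alg : MediatorFeedback.Algorithm (Fin 2) ℝ ℝ 2,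
        1 / (8 * Δ) * Real.log (Δ ^ 2 * n) ≤
          max (MediatorFeedback.expRegret ν₁ π alg n) (MediatorFeedback.expRegret ν₂ π alg n) := by
  open MediatorFeedback in
  refine ⟨gaussianMDP Δ, gaussianMDP (-Δ), gaussianDiracPolicy, fun _ => rfl, fun _ => rfl, rfl,
    rfl, rfl, ?_, ?_, ?_, fun n hn alg => log_le_max_expRegret alg n hΔ hn⟩
  · rintro ν (rfl | rfl)
    · exact ⟨(klDiv_trajLaw_eq_top _).1, (klDiv_trajLaw_eq_top _).2,
        integrable_ret_gaussianDiracPolicy _⟩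
    · exact ⟨(klDiv_trajLaw_eq_top _).1, (klDiv_trajLaw_eq_top _).2,
        integrable_ret_gaussianDiracPolicy _⟩
  · rw [expReturn_zero, expReturn_one, sub_zero]
  · rw [expReturn_zero, expReturn_one, sub_neg_eq_add, zero_add]
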